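/- Let $\mu>0$, $0\le\alpha<1$, and consider a Hawkes process with base rate $\mu$, excitation rate $\alpha$ and decay rate $1$, i.e. with conditional intensity $$\lambda^*_t=\mu+\sum_{t_i<t}\alpha e^{-(t-t_i)},$$ where the sum runs over all earlier events, observed from time $0$ until time $T$. The past before time $0$ is arbitrary (possibly empty, possibly random and infinite, as for the stationary process); it enters only through a nonnegative random variable $R=\sum_{t_i\le 0}\alpha e^{t_i}$, known at time $0$, which adds $Re^{-t}$ to the intensity at time $t>0$. In the immigration–birth representation, given the history and that an event occurs at time $t$, this event is an immigrant with probability $\mu/\lambda^*_t$ and a child of the earlier event $i$ with probability $\alpha e^{-(t-t_i)}/\lambda^*_t$. The tree (cluster) of an immigrant consists of this immigrant and all its direct and indirect offspring. Let $0<\gamma\le 1$ and $$T\ \ge\ \Big(\frac{\mu e^2}{\gamma}\Big)^{5/2}.$$ Then, with probability at least $1-\gamma$, the tree of every immigrant that arrives during the observation period $(0,T]$ is finite and contains at most $\dfrac{3\log T}{(1-\alpha)^2}$ events, even when the offspring born after time $T$ are counted. In particular, if there are no events before time $0$, then with probability at least $1-\gamma$ all trees observed until time $T$ contain at most $\frac{3\log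 T}{(1-\alpha)^2}$ events. -/

import Mathlib

open MeasureTheory

/-- The possible causes of an event arriving after time `0` in the immigration-birth
representation: it is an immigrant (an arrival of the background Poisson process), or a child of
some event that happened before the observation started (at a time `≤ 0`), or a child of the
`i`-th event after time `0`. -/
inductive HawkesCause where
  | immigrant : HawkesCause
  | past : HawkesCause
  | event (i : ℕ) : HawkesCause

/-- The intensity at time `u` contributed by one cause, when the events numbered `0, …, n - 1`,
at the times `t 0, …, t (n - 1)`, have already happened: `μ` for immigration, `α e^{-(u - t i)}` for
the `i`-th event. An event at a time `z ≤ 0` contributes `α e^{-(u - z)} = α e^z e^{-u}`, so that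
the events before the observation contribute `R e^{-u}` together, where `R` is the sum of
`α e^z` over these events. -/
noncomputable def hawkesCauseIntensity (μ α R : ℝ) (t : ℕ → ℝ) (n : ℕ)
    (k : HawkesCause) (u : ℝ) : ℝ :=
  match k with
  | .immigrant => μ
  | .past => R * Real.exp (-u)
  | .event i => if i < n then α * Real.exp (-(u - t i)) else 0

/-- The Hawkes intensity at time `u` with decay rate `1`, when the events numbered `0, …, n - 1`
have already happened after time `0`. -/
noncomputable def hawkesIntensity (μ α R : ℝ) (t : ℕ → ℝ) (n : ℕ) (u : ℝ) : ℝ :=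
  μ + R * Real.exp (-u) + ∑ i ∈ Finset.range n, α * Real.exp (-(u - t i))

/-- The time at which the waiting for the event number `n` begins: `0` for the first event, and the
time of the preceding event for the later ones. -/
def hawkesLastTime (t : ℕ → ℝ) : ℕ → ℝ
  | 0 => 0
  | n + 1 => t n

/-- The sequence of events after time `0` of a Hawkes process with base rate `μ`, excitation rate
`α` and decay rate `1`, together with its immigration-birth structure. The event number `n` (counted
from `0`) arrives at time `t n` and has the cause `c n`; `R` is the excitation that is left at time
`0` from earlier events (`R = 0` when there are none), and `𝓕 n` is the information available just
after the first `n` events.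

The field `density` says that `hawkesIntensity` is the conditional intensity (hazard rate): given
`𝓕 n`, the time of the event number `n` has the density `u ↦ λ u * exp (-∫ v in s..u, λ v)` on
`(s, ∞)`, where `s` is the time of the preceding event and `λ` the Hawkes intensity; and an event at
time `u` is due to each cause with probability `hawkesCauseIntensity` divided by `λ u`. -/
structure IsHawkesProcess {Ω : Type*} [mΩ : MeasurableSpace Ω] (P : Measure Ω)
    (𝓕 : Filtration ℕ mΩ) (μ α : ℝ) (R : Ω → ℝ) (t : ℕ → Ω → ℝ) (c : ℕ → Ω → HawkesCause) :
    Prop where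
  measurable_past : Measurable[𝓕 0] R
  past_nonneg : ∀ ω, 0 ≤ R ω
  measurable_time : ∀ n, Measurable[𝓕 (n + 1)] (t n)
  measurable_cause : ∀ n k, MeasurableSet[𝓕 (n + 1)] {ω | c n ω = k}
  density : ∀ (n : ℕ) (k : HawkesCause) (A : Set Ω) (B : Set ℝ),
    MeasurableSet[𝓕 n] A → MeasurableSet B →
      P {ω | ω ∈ A ∧ t n ω ∈ B ∧ c n ω = k} =
        ∫⁻ ω in A, ∫⁻ u in B ∩ Set.Ioi (hawkesLastTime (fun i => t i ω) n),
          ENNReal.ofReal (hawkesCauseIntensity μ α (R ω) (fun i => t i ω) n k u *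
            Real.exp (-∫ v in (hawkesLastTime (fun i => t i ω) n)..u,
              hawkesIntensity μ α (R ω) (fun i => t i ω) n v)) ∂volume ∂P

/-- `HawkesDescendant c r j`: the event `j` is the event `r` or one of its direct or indirect
offspring. -/
inductive HawkesDescendant (c : ℕ → HawkesCause) (r : ℕ) : ℕ → Prop where
  | root : HawkesDescendant c r r
  | child {i j : ℕ} : HawkesDescendant c r i → c j = .event i → HawkesDescendant c r j

/-- The tree (cluster) of the event `r`: this event with all its offspring, of all generations and
at all times. -/
def hawkesTree (c : ℕ → HawkesCause) (r : ℕ) : Set ℕ := {j | HawkesDescendant c r j}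

/-! The proof is a union bound over the immigrants arriving until `T`, combined with an exponential
tail for each tree.

For one tree, fix `g ≥ 1` and put `θ = log g - α (g - 1)`. If `S` is the part of the tree born so
far, consider `exp (θ |S| + (g - 1) m)`, where `m` is the mean number of direct children that
members of `S` will still have. Between events the decay of `m` exactly compensates the factor `g`
gained when a child is born, so this is a supermartingale along the event numbers
(`lintegral_hawkesDensity_mul_tilt_le`, `setLIntegral_potential_le`). It starts at `g` when the root
is born. Markov's inequality bounds the probability of more than `x` events by `g exp (-θ x)`,
conditionally on the history at the birth of the root (`measure_inter_lt_card_treeUpTo_le`). Event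
numbers are unbounded, so offspring after `T` are included.

The mean number of immigrants until `T` is at most `μ T` (`tsum_measure_immigrant_le`). A choice of
`g ≤ e²` with `θ ≥ (1 - α)² / 2` (`exists_sq_div_two_le_log_sub`) makes the total failure
probability at most `e² μ T^(-1/2) ≤ γ` when `T ≥ 1`. For `T ≤ 1`, already the presence of an
immigrant has probability at most `γ`. -/

/-- If the joint law of `π` and `X` on the event `E` has the conditional density `q` given `π` on
rectangles, then so it has for all nonnegative functions. -/
theorem setLIntegral_comp_eq_lintegral_density {Ω Ω' : Type*} [MeasurableSpace Ω]
    [MeasurableSpace Ω'] (P : Measure Ω) [IsFiniteMeasure P] {π : Ω → Ω'} (hπ : Measurable π)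
    {X : Ω → ℝ} (hX : Measurable X) {E : Set Ω} {q : Ω' × ℝ → ENNReal} (hq : Measurable q)
    (h : ∀ A B, MeasurableSet A → MeasurableSet B →
      P (π ⁻¹' A ∩ X ⁻¹' B ∩ E) = ∫⁻ ω in π ⁻¹' A, ∫⁻ u in B, q (π ω, u) ∂volume ∂P)
    {F : Ω' × ℝ → ENNReal} (hF : Measurable F) :
    ∫⁻ ω in E, F (π ω, X ω) ∂P = ∫⁻ ω, ∫⁻ u, q (π ω, u) * F (π ω, u) ∂volume ∂P := by
  have hm : Measurable fun ω => (π ω, X ω) := hπ.prodMk hX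
  have key : (P.restrict E).map (fun ω => (π ω, X ω)) =
      ((P.map π).prod volume).withDensity q := by
    refine Measure.ext_prod ?_
    intro A B hA hB
    rw [Measure.map_apply hm (hA.prod hB), Measure.restrict_apply (hm (hA.prod hB)),
      withDensity_apply _ (hA.prod hB), ← Measure.prod_restrict, lintegral_prod _ hq.aemeasurable,
      Measure.restrict_map hπ hA, lintegral_map hq.lintegral_prod_right' hπ, ← h A B hA hB]
    rfl
  calc ∫⁻ ω in E, F (π ω, X ω) ∂P
      = ∫⁻ z, F z ∂((P.restrict E).map (fun ω => (π ω, X ω))) := (lintegral_map hF hm).symm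
    _ = ∫⁻ z, (q * F) z ∂((P.map π).prod volume) := by
        rw [key, lintegral_withDensity_eq_lintegral_mul _ hq hF]
    _ = _ := by
        rw [lintegral_prod _ (hq.mul hF).aemeasurable,
          lintegral_map (hq.mul hF).lintegral_prod_right' hπ]
        rfl

/-! ### Compensator and density of the next event -/

/-- The integral of the Hawkes intensity between `s` and `u`. -/
noncomputable def hawkesCompensator (μ α R : ℝ) (t : ℕ → ℝ) (n : ℕ) (s u : ℝ) : ℝ :=
  μ * (u - s) + R * (Real.exp (-s) - Real.exp (-u)) +
    ∑ i ∈ Finset.range n, α * (Real.exp (-(s - t i)) - Real.exp (-(u - t i)))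

theorem hasDerivAt_exp_neg_sub (a u : ℝ) :
    HasDerivAt (fun u => Real.exp (-(u - a))) (-Real.exp (-(u - a))) u := by
  simpa using ((hasDerivAt_id u).sub_const a).neg.exp

theorem hasDerivAt_hawkesCompensator (μ α R : ℝ) (t : ℕ → ℝ) (n : ℕ) (s u : ℝ) :
    HasDerivAt (hawkesCompensator μ α R t n s) (hawkesIntensity μ α R t n u) u := by
  have h1 : HasDerivAt (fun u => μ * (u - s)) μ u := by
    simpa using ((hasDerivAt_id u).sub_const s).const_mul μ
  have h2 : HasDerivAt (fun u => R * (Real.exp (-s) - Real.exp (-u))) (R * Real.exp (-u)) u := by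
    simpa using ((hasDerivAt_exp_neg_sub 0 u).const_sub (Real.exp (-s))).const_mul R
  have h3 : HasDerivAt (fun u => ∑ i ∈ Finset.range n,
      α * (Real.exp (-(s - t i)) - Real.exp (-(u - t i))))
      (∑ i ∈ Finset.range n, α * Real.exp (-(u - t i))) u := by
    refine HasDerivAt.fun_sum fun i _ => ?_
    simpa using ((hasDerivAt_exp_neg_sub (t i) u).const_sub (Real.exp (-(s - t i)))).const_mul α
  exact (h1.add h2).add h3

theorem continuous_hawkesIntensity (μ α R : ℝ) (t : ℕ → ℝ) (n : ℕ) :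
    Continuous (hawkesIntensity μ α R t n) := by
  unfold hawkesIntensity
  fun_prop

theorem integral_hawkesIntensity (μ α R : ℝ) (t : ℕ → ℝ) (n : ℕ) (s u : ℝ) :
    ∫ v in s..u, hawkesIntensity μ α R t n v = hawkesCompensator μ α R t n s u := by
  rw [intervalIntegral.integral_eq_sub_of_hasDerivAt
    (fun v _ => hasDerivAt_hawkesCompensator μ α R t n s v)
    ((continuous_hawkesIntensity μ α R t n).intervalIntegrable _ _)]
  simp [hawkesCompensator]

theorem hawkesCompensator_self (μ α R : ℝ) (t : ℕ → ℝ) (n : ℕ) (s : ℝ) :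
    hawkesCompensator μ α R t n s s = 0 := by
  simp [hawkesCompensator]

/-- Immigration alone makes the compensator grow linearly; this is what forces the boundary term at
infinity to vanish in the exponential inequality. -/
theorem le_hawkesCompensator {μ α R : ℝ} (hα : 0 ≤ α) (hR : 0 ≤ R) (t : ℕ → ℝ) (n : ℕ)
    {s u : ℝ} (hsu : s ≤ u) : μ * (u - s) ≤ hawkesCompensator μ α R t n s u := by
  have h1 : 0 ≤ R * (Real.exp (-s) - Real.exp (-u)) :=
    mul_nonneg hR (sub_nonneg.2 (Real.exp_le_exp.2 (by linarith)))
  have h2 : 0 ≤ ∑ i ∈ Finset.range n, α * (Real.exp (-(s - t i)) - Real.exp (-(u - t i))) :=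
    Finset.sum_nonneg fun i _ =>
      mul_nonneg hα (sub_nonneg.2 (Real.exp_le_exp.2 (by linarith)))
  unfold hawkesCompensator
  linarith

/-- The density of the next event at time `u` with the cause `k`. -/
noncomputable def hawkesDensity {Ω : Type*} (μ α : ℝ) (R : Ω → ℝ) (t : ℕ → Ω → ℝ) (n : ℕ)
    (k : HawkesCause) (z : Ω × ℝ) : ENNReal :=
  ENNReal.ofReal (hawkesCauseIntensity μ α (R z.1) (fun i => t i z.1) n k z.2 *
    Real.exp (-hawkesCompensator μ α (R z.1) (fun i => t i z.1) n
      (hawkesLastTime (fun i => t i z.1) n) z.2))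

theorem measurable_hawkesLastTime {Ω : Type*} [MeasurableSpace Ω] {t : ℕ → Ω → ℝ} {n : ℕ}
    (ht : ∀ i < n, Measurable (t i)) : Measurable fun ω => hawkesLastTime (fun i => t i ω) n := by
  cases n with
  | zero => exact measurable_const
  | succ n => exact ht n n.lt_succ_self

theorem measurableSet_hawkesLastTime_lt {Ω : Type*} [MeasurableSpace Ω] {t : ℕ → Ω → ℝ} {n : ℕ}
    (ht : ∀ i < n, Measurable (t i)) :
    MeasurableSet {z : Ω × ℝ | hawkesLastTime (fun i => t i z.1) n < z.2} :=
  measurableSet_lt ((measurable_hawkesLastTime ht).comp measurable_fst) measurable_snd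

theorem measurable_hawkesDensity {Ω : Type*} [MeasurableSpace Ω] (μ α : ℝ) {R : Ω → ℝ}
    {t : ℕ → Ω → ℝ} {n : ℕ} (hR : Measurable R) (ht : ∀ i < n, Measurable (t i))
    (k : HawkesCause) : Measurable (hawkesDensity μ α R t n k) := by
  have hs : Measurable fun z : Ω × ℝ => hawkesLastTime (fun i => t i z.1) n :=
    (measurable_hawkesLastTime ht).comp measurable_fst
  have ht' : ∀ i < n, Measurable fun z : Ω × ℝ => t i z.1 := fun i hi =>
    (ht i hi).comp measurable_fst
  clear ht
  unfold hawkesDensity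
  refine ENNReal.measurable_ofReal.comp (Measurable.mul ?_ ?_)
  · cases k with
    | immigrant => exact measurable_const
    | past => simp only [hawkesCauseIntensity]; fun_prop
    | event i =>
      simp only [hawkesCauseIntensity]
      split_ifs with hi
      · exact (Real.measurable_exp.comp (measurable_snd.sub (ht' i hi)).neg).const_mul α
      · exact measurable_const
  · unfold hawkesCompensator
    have : Measurable fun z : Ω × ℝ => ∑ i ∈ Finset.range n,
        α * (Real.exp (-(hawkesLastTime (fun i => t i z.1) n - t i z.1)) -
          Real.exp (-(z.2 - t i z.1))) := by
      refine Finset.measurable_fun_sum _ fun i hi => ?_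
      have hi' := ht' i (Finset.mem_range.1 hi)
      exact ((Real.measurable_exp.comp (hs.sub hi').neg).sub
        (Real.measurable_exp.comp (measurable_snd.sub hi').neg)).const_mul α
    fun_prop

theorem measurable_indicator_hawkesDensity {Ω : Type*} [MeasurableSpace Ω] (μ α : ℝ) {R : Ω → ℝ}
    {t : ℕ → Ω → ℝ} {n : ℕ} (hR : Measurable R) (ht : ∀ i < n, Measurable (t i))
    (k : HawkesCause) :
    Measurable ({z : Ω × ℝ | hawkesLastTime (fun i => t i z.1) n < z.2}.indicator
      (hawkesDensity μ α R t n k)) :=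
  (measurable_hawkesDensity μ α hR ht k).indicator (measurableSet_hawkesLastTime_lt ht)

/-! ### Averaging over the next event -/

namespace IsHawkesProcess

variable {Ω : Type*} [mΩ : MeasurableSpace Ω] {P : Measure Ω} {𝓕 : Filtration ℕ mΩ} {μ α : ℝ}
  {R : Ω → ℝ} {t : ℕ → Ω → ℝ} {c : ℕ → Ω → HawkesCause}

theorem measurable_time_of_lt (hH : IsHawkesProcess P 𝓕 μ α R t c) {i n : ℕ} (h : i < n) :
    Measurable[𝓕 n] (t i) :=
  (hH.measurable_time i).mono (𝓕.mono h) le_rfl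

theorem measurable_past_of_le (hH : IsHawkesProcess P 𝓕 μ α R t c) (n : ℕ) :
    Measurable[𝓕 n] R :=
  hH.measurable_past.mono (𝓕.mono n.zero_le) le_rfl

theorem measurable_density (hH : IsHawkesProcess P 𝓕 μ α R t c) (n : ℕ) (k : HawkesCause) :
    @Measurable _ _ (@Prod.instMeasurableSpace Ω ℝ (𝓕 n) _) _ (hawkesDensity μ α R t n k) :=
  @measurable_hawkesDensity Ω (𝓕 n) μ α R t n (hH.measurable_past_of_le n)
    (fun _ hi => hH.measurable_time_of_lt hi) k

theorem setLIntegral_cause [IsFiniteMeasure P] (hH : IsHawkesProcess P 𝓕 μ α R t c) (n : ℕ)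
    (k : HawkesCause) {F : Ω × ℝ → ENNReal}
    (hF : @Measurable _ _ (@Prod.instMeasurableSpace Ω ℝ (𝓕 n) _) _ F) :
    ∫⁻ ω in {ω | c n ω = k}, F (ω, t n ω) ∂P =
      ∫⁻ ω, ∫⁻ u in Set.Ioi (hawkesLastTime (fun i => t i ω) n),
        hawkesDensity μ α R t n k (ω, u) * F (ω, u) ∂volume ∂P := by
  -- The history is `Ω` itself with the coarser σ-algebra `𝓕 n`, and `π` is the identity. Thus `F`
  -- may depend on everything known after `n` events.
  have := @setLIntegral_comp_eq_lintegral_density Ω Ω mΩ (𝓕 n) P _ id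
    (measurable_id'' (𝓕.le n)) (t n) ((hH.measurable_time n).mono (𝓕.le _) le_rfl)
    {ω | c n ω = k}
    ({z : Ω × ℝ | hawkesLastTime (fun i => t i z.1) n < z.2}.indicator (hawkesDensity μ α R t n k))
    (@measurable_indicator_hawkesDensity Ω (𝓕 n) μ α R t n (hH.measurable_past_of_le n)
      (fun _ hi => hH.measurable_time_of_lt hi) k) ?_ F hF
  · refine this.trans (lintegral_congr fun ω => ?_)
    rw [← lintegral_indicator measurableSet_Ioi]
    refine lintegral_congr fun u => ?_
    by_cases h : hawkesLastTime (fun i => t i ω) n < u <;> simp [Set.indicator, h]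
  · intro A B hA hB
    have := hH.density n k A B hA hB
    simp only [Set.preimage_id]
    calc P (A ∩ t n ⁻¹' B ∩ {ω | c n ω = k}) = P {ω | ω ∈ A ∧ t n ω ∈ B ∧ c n ω = k} := by
          congr 1; ext ω; simp [and_assoc]; tauto
      _ = _ := by
          rw [this]
          refine lintegral_congr fun ω => ?_
          rw [Set.inter_comm, ← Measure.restrict_restrict measurableSet_Ioi,
            ← lintegral_indicator measurableSet_Ioi]
          refine lintegral_congr fun u => ?_
          simp only [Set.indicator, hawkesDensity, integral_hawkesIntensity, Set.mem_Ioi,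
            Set.mem_ofPred_eq, id]

/-- Almost surely, every event is an immigrant or a child of an earlier event. -/
theorem ae_cause_lt [IsFiniteMeasure P] (hH : IsHawkesProcess P 𝓕 μ α R t c) :
    ∀ᵐ ω ∂P, ∀ n i, c n ω = .event i → i < n := by
  rw [ae_all_iff]; intro n
  rw [ae_all_iff]; intro i
  by_cases h : i < n
  · simp [h]
  have := hH.density n (.event i) Set.univ Set.univ MeasurableSet.univ MeasurableSet.univ
  simpa [h, hawkesCauseIntensity, ae_iff] using this

/-- The mean value of a function of the cause and time of the next event and of the history. -/
theorem lintegral_next [IsFiniteMeasure P] (hH : IsHawkesProcess P 𝓕 μ α R t c) (n : ℕ)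
    {F : HawkesCause → Ω × ℝ → ENNReal}
    (hF : ∀ k, @Measurable _ _ (@Prod.instMeasurableSpace Ω ℝ (𝓕 n) _) _ (F k)) :
    ∫⁻ ω, F (c n ω) (ω, t n ω) ∂P ≤
      ∫⁻ ω, ∫⁻ u in Set.Ioi (hawkesLastTime (fun i => t i ω) n),
        (hawkesDensity μ α R t n .immigrant (ω, u) * F .immigrant (ω, u) +
        hawkesDensity μ α R t n .past (ω, u) * F .past (ω, u) +
        ∑ i ∈ Finset.range n, hawkesDensity μ α R t n (.event i) (ω, u) * F (.event i) (ω, u))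
          ∂volume ∂P := by
  have hle : @Prod.instMeasurableSpace Ω ℝ (𝓕 n) _ ≤ @Prod.instMeasurableSpace Ω ℝ mΩ _ :=
    sup_le_sup (MeasurableSpace.comap_mono (𝓕.le n)) le_rfl
  have hm : ∀ k, Measurable fun z => hawkesDensity μ α R t n k z * F k z := fun k =>
    ((hH.measurable_density n k).mono hle le_rfl).mul ((hF k).mono hle le_rfl)
  have hm' : ∀ k ω, Measurable fun u => hawkesDensity μ α R t n k (ω, u) * F k (ω, u) :=
    fun k ω => (hm k).comp measurable_prodMk_left
  have hS : MeasurableSet {z : Ω × ℝ | hawkesLastTime (fun i => t i z.1) n < z.2} :=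
    measurableSet_hawkesLastTime_lt fun _ hi =>
      (hH.measurable_time_of_lt hi).mono (𝓕.le n) le_rfl
  have hmI : ∀ k, Measurable fun ω => ∫⁻ u in Set.Ioi (hawkesLastTime (fun i => t i ω) n),
      hawkesDensity μ α R t n k (ω, u) * F k (ω, u) := by
    intro k
    convert ((hm k).indicator hS).lintegral_prod_right' (ν := volume) using 2 with ω
    rw [← lintegral_indicator measurableSet_Ioi]
    rfl
  have hcov : ∀ᵐ ω ∂P, ω ∈ ({ω | c n ω = .immigrant} ∪ {ω | c n ω = .past}) ∪
      ⋃ i ∈ Finset.range n, {ω | c n ω = .event i} := by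
    filter_upwards [hH.ae_cause_lt] with ω hω
    rcases h : c n ω with _ | _ | i
    · simp [h]
    · simp [h]
    · simp [h, hω n i h]
  have hval : ∀ k, ∫⁻ ω in {ω | c n ω = k}, F (c n ω) (ω, t n ω) ∂P =
      ∫⁻ ω, ∫⁻ u in Set.Ioi (hawkesLastTime (fun i => t i ω) n),
        hawkesDensity μ α R t n k (ω, u) * F k (ω, u) ∂volume ∂P := by
    intro k
    rw [← hH.setLIntegral_cause n k (hF k)]
    refine setLIntegral_congr_fun (𝓕.le _ _ (hH.measurable_cause n k)) fun ω hω => ?_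
    rw [show c n ω = k from hω]
  calc ∫⁻ ω, F (c n ω) (ω, t n ω) ∂P
      = ∫⁻ ω in ({ω | c n ω = .immigrant} ∪ {ω | c n ω = .past}) ∪
          ⋃ i ∈ Finset.range n, {ω | c n ω = .event i}, F (c n ω) (ω, t n ω) ∂P := by
        rw [Measure.restrict_eq_self_of_ae_mem hcov]
    _ ≤ (∫⁻ ω in {ω | c n ω = .immigrant}, F (c n ω) (ω, t n ω) ∂P +
          ∫⁻ ω in {ω | c n ω = .past}, F (c n ω) (ω, t n ω) ∂P) +
          ∑ i ∈ Finset.range n, ∫⁻ ω in {ω | c n ω = .event i}, F (c n ω) (ω, t n ω) ∂P := by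
        refine (lintegral_union_le _ _ _).trans (add_le_add (lintegral_union_le _ _ _) ?_)
        refine (lintegral_biUnion_finset ?_ (fun i _ => 𝓕.le _ _ (hH.measurable_cause n _)) _).le
        intro i _ j _ hij
        refine Set.disjoint_left.2 fun ω hi hj => hij ?_
        simpa using (show c n ω = _ from hi).symm.trans hj
    _ = _ := by
        simp only [hval]
        symm
        have h : ∀ ω, ∫⁻ u in Set.Ioi (hawkesLastTime (fun i => t i ω) n),
            (hawkesDensity μ α R t n .immigrant (ω, u) * F .immigrant (ω, u) +
            hawkesDensity μ α R t n .past (ω, u) * F .past (ω, u) +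
            ∑ i ∈ Finset.range n,
              hawkesDensity μ α R t n (.event i) (ω, u) * F (.event i) (ω, u)) = _ := fun ω => by
          rw [lintegral_add_left ((hm' _ ω).fun_add (hm' _ ω)), lintegral_add_left (hm' _ ω),
            lintegral_finsetSum _ (fun i _ => hm' _ ω)]
        rw [lintegral_congr h, lintegral_add_left ((hmI _).fun_add (hmI _)),
          lintegral_add_left (hmI _), lintegral_finsetSum _ (fun i _ => hmI _)]

end IsHawkesProcess

/-! ### One-step inequalities between successive events -/

open Filter Topology in
theorem lintegral_Ioi_neg_deriv_le {f f' : ℝ → ℝ} {s : ℝ} (hf : ∀ u, HasDerivAt f (-f' u) u)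
    (hf' : ∀ u ∈ Set.Ioi s, 0 ≤ f' u) (hlim : Tendsto f atTop (𝓝 0)) :
    ∫⁻ u in Set.Ioi s, ENNReal.ofReal (f' u) ≤ ENNReal.ofReal (f s) := by
  have hd : ∀ u ∈ Set.Ici s, HasDerivAt (fun u => -f u) (f' u) u := fun u _ =>
    (hf u).neg.congr_deriv (neg_neg _)
  have hl : Tendsto (fun u => -f u) atTop (𝓝 0) := by simpa using hlim.neg
  rw [← ofReal_integral_eq_lintegral_ofReal (integrableOn_Ioi_deriv_of_nonneg' hd hf' hl)
    ((ae_restrict_iff' measurableSet_Ioi).2 (ae_of_all _ hf')),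
    integral_Ioi_of_hasDerivAt_of_nonneg' hd hf' hl]
  simp

theorem hawkesCauseIntensity_nonneg {μ α R : ℝ} (hμ : 0 ≤ μ) (hα : 0 ≤ α) (hR : 0 ≤ R)
    (t : ℕ → ℝ) (n : ℕ) (k : HawkesCause) (u : ℝ) : 0 ≤ hawkesCauseIntensity μ α R t n k u := by
  cases k with
  | immigrant => exact hμ
  | past => exact mul_nonneg hR (Real.exp_nonneg _)
  | event i =>
    simp only [hawkesCauseIntensity]
    split_ifs <;> positivity

theorem hawkesIntensity_nonneg {μ α R : ℝ} (hμ : 0 ≤ μ) (hα : 0 ≤ α) (hR : 0 ≤ R)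
    (t : ℕ → ℝ) (n : ℕ) (u : ℝ) : 0 ≤ hawkesIntensity μ α R t n u := by
  unfold hawkesIntensity
  positivity

/-- The logarithm of the mean of the product of the weights of all direct offspring arriving after
time `u`, when each child of the event `i < n` has the weight `w i`. -/
noncomputable def hawkesTilt (α : ℝ) (t : ℕ → ℝ) (n : ℕ) (w : ℕ → ℝ) (u : ℝ) : ℝ :=
  ∑ i ∈ Finset.range n, (w i - 1) * (α * Real.exp (-(u - t i)))

/-- With decay rate `1` every summand solves `Z' = -Z`: the expected remaining offspring decreases
at the rate at which it is being born. -/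
theorem hasDerivAt_hawkesTilt (α : ℝ) (t : ℕ → ℝ) (n : ℕ) (w : ℕ → ℝ) (u : ℝ) :
    HasDerivAt (hawkesTilt α t n w) (-hawkesTilt α t n w u) u := by
  unfold hawkesTilt
  rw [← Finset.sum_neg_distrib]
  refine HasDerivAt.fun_sum fun i _ => ?_
  simpa using ((hasDerivAt_exp_neg_sub (t i) u).const_mul α).const_mul (w i - 1)

open Filter Topology in
theorem tendsto_hawkesTilt (α : ℝ) (t : ℕ → ℝ) (n : ℕ) (w : ℕ → ℝ) :
    Tendsto (hawkesTilt α t n w) atTop (𝓝 0) := by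
  have : Tendsto (hawkesTilt α t n w) atTop
      (𝓝 (∑ i ∈ Finset.range n, (w i - 1) * (α * 0))) := by
    refine tendsto_finsetSum _ fun i _ => ((Tendsto.const_mul _ ?_).const_mul _)
    refine Real.tendsto_exp_neg_atTop_nhds_zero.comp ?_
    exact tendsto_atTop_add_const_right _ (-t i) tendsto_id
  simpa using this

open Filter Topology in
/-- The exponential martingale inequality, between two successive events. -/
theorem lintegral_hawkesDensity_mul_tilt_le {Ω : Type*} {μ α : ℝ} {R : Ω → ℝ} (hμ : 0 < μ)
    (hα : 0 ≤ α) (t : ℕ → Ω → ℝ) (n : ℕ) {w : ℕ → ℝ} (hw : ∀ i, 0 ≤ w i) (a : ℝ) {ω : Ω}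
    (hR : 0 ≤ R ω) :
    ∫⁻ u in Set.Ioi (hawkesLastTime (fun i => t i ω) n),
      (hawkesDensity μ α R t n .immigrant (ω, u) *
        ENNReal.ofReal (1 * Real.exp (a + hawkesTilt α (fun i => t i ω) n w u)) +
      hawkesDensity μ α R t n .past (ω, u) *
        ENNReal.ofReal (1 * Real.exp (a + hawkesTilt α (fun i => t i ω) n w u)) +
      ∑ i ∈ Finset.range n, hawkesDensity μ α R t n (.event i) (ω, u) *
        ENNReal.ofReal (w i * Real.exp (a + hawkesTilt α (fun i => t i ω) n w u))) ≤
      ENNReal.ofReal (Real.exp (a + hawkesTilt α (fun i => t i ω) n w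
        (hawkesLastTime (fun i => t i ω) n))) := by
  set s := hawkesLastTime (fun i => t i ω) n with hs
  set Z := hawkesTilt α (fun i => t i ω) n w
  set L := hawkesCompensator μ α (R ω) (fun i => t i ω) n s
  set f : ℝ → ℝ := fun u => Real.exp (a + Z u - L u)
  set f' : ℝ → ℝ := fun u => (μ + R ω * Real.exp (-u) + ∑ i ∈ Finset.range n,
    w i * (α * Real.exp (-(u - t i ω)))) * f u
  -- Since `Z' = -Z` and `L' = λ`, the logarithmic derivative of `f` is `-(λ + Z)`. Adding `Z` to
  -- `λ` replaces each excitation term by `w i` times itself, so `f'` is the integrand of the claim.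
  have hf : ∀ u, HasDerivAt f (-f' u) u := by
    intro u
    have h1 := (((hasDerivAt_hawkesTilt α (fun i => t i ω) n w u).const_add a).sub
      (hasDerivAt_hawkesCompensator μ α (R ω) (fun i => t i ω) n s u)).exp
    refine h1.congr_deriv ?_
    have : hawkesTilt α (fun i => t i ω) n w u = ∑ i ∈ Finset.range n,
        w i * (α * Real.exp (-(u - t i ω))) - ∑ i ∈ Finset.range n, α * Real.exp (-(u - t i ω)) := by
      simp [hawkesTilt, ← Finset.sum_sub_distrib, sub_mul]
    rw [mul_comm, this]
    simp only [f', f, hawkesIntensity, Pi.sub_apply]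
    ring
  have hlim : Tendsto f atTop (𝓝 0) := by
    refine Real.tendsto_exp_atBot.comp ?_
    have h1 : Tendsto L atTop atTop := by
      refine tendsto_atTop_mono' _ (f₁ := fun u => μ * (u - s)) ?_ ?_
      · filter_upwards [eventually_ge_atTop s] with u hu using le_hawkesCompensator hα hR _ _ hu
      · exact (tendsto_atTop_add_const_right _ (-s) tendsto_id).const_mul_atTop hμ
    have h2 : Tendsto (fun u => a + Z u) atTop (𝓝 (a + 0)) :=
      (tendsto_hawkesTilt α _ n w).const_add a
    exact h2.add_atBot (tendsto_neg_atTop_atBot.comp h1)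
  have hf' : ∀ u ∈ Set.Ioi s, 0 ≤ f' u := by
    intro u _
    refine mul_nonneg (add_nonneg (by positivity) (Finset.sum_nonneg fun i _ => ?_))
      (Real.exp_nonneg _)
    exact mul_nonneg (hw i) (by positivity)
  have hfs : f s = Real.exp (a + Z s) := by
    simp [f, L, hawkesCompensator_self]
  rw [← hfs]
  refine le_trans (le_of_eq ?_) (lintegral_Ioi_neg_deriv_le hf hf' hlim)
  refine lintegral_congr fun u => ?_
  have hd : ∀ k, 0 ≤ hawkesCauseIntensity μ α (R ω) (fun i => t i ω) n k u * Real.exp (-L u) :=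
    fun k => mul_nonneg (hawkesCauseIntensity_nonneg hμ.le hα hR _ _ _ _) (Real.exp_nonneg _)
  have hd' : ∀ k (v : ℝ), hawkesDensity μ α R t n k (ω, u) * ENNReal.ofReal v =
      ENNReal.ofReal (hawkesCauseIntensity μ α (R ω) (fun i => t i ω) n k u * Real.exp (-L u) * v) :=
    fun k v => (ENNReal.ofReal_mul (hd k)).symm
  have hn : ∀ k (v : ℝ), 0 ≤ v →
      0 ≤ hawkesCauseIntensity μ α (R ω) (fun i => t i ω) n k u * Real.exp (-L u) * v :=
    fun k v hv => mul_nonneg (hd k) hv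
  have hE : 0 ≤ Real.exp (a + Z u) := Real.exp_nonneg _
  simp only [hd']
  rw [← ENNReal.ofReal_sum_of_nonneg fun i _ => hn _ _ (mul_nonneg (hw i) hE),
    ← ENNReal.ofReal_add (hn _ _ (by simpa using hE)) (hn _ _ (by simpa using hE)),
    ← ENNReal.ofReal_add (add_nonneg (hn _ _ (by simpa using hE)) (hn _ _ (by simpa using hE)))
      (Finset.sum_nonneg fun i _ => hn _ _ (mul_nonneg (hw i) hE))]
  congr 1
  have hfu : f u = Real.exp (a + Z u) * Real.exp (-L u) := by
    rw [← Real.exp_add, ← sub_eq_add_neg]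
  simp only [f', hfu, hawkesCauseIntensity]
  rw [add_mul, Finset.sum_mul]
  congr 1
  · ring
  · refine Finset.sum_congr rfl fun i hi => ?_
    rw [if_pos (Finset.mem_range.1 hi)]
    ring

/-- The mean number of immigrants until `T`, between two successive events. -/
theorem lintegral_hawkesDensity_immigrant_le {Ω : Type*} {μ α : ℝ} {R : Ω → ℝ} (hμ : 0 < μ)
    (hα : 0 ≤ α) (t : ℕ → Ω → ℝ) (n : ℕ) (T : ℝ) {ω : Ω} (hR : 0 ≤ R ω) :
    ∫⁻ u in Set.Ioi (hawkesLastTime (fun i => t i ω) n),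
      (hawkesDensity μ α R t n .immigrant (ω, u) *
        (ENNReal.ofReal (μ * (T - u)) + (Set.Iic T).indicator 1 u) +
      hawkesDensity μ α R t n .past (ω, u) * ENNReal.ofReal (μ * (T - u)) +
      ∑ i ∈ Finset.range n, hawkesDensity μ α R t n (.event i) (ω, u) *
        ENNReal.ofReal (μ * (T - u))) ≤
      ENNReal.ofReal (μ * (T - hawkesLastTime (fun i => t i ω) n)) := by
  set s := hawkesLastTime (fun i => t i ω) n with hs
  set L := hawkesCompensator μ α (R ω) (fun i => t i ω) n s
  -- An explicit antiderivative: differentiating `T - u` yields the term counting an immigrant, and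
  -- differentiating `exp (-L)` yields the mean still to come after the next event.
  set f : ℝ → ℝ := fun u => -(μ * (T - u) * Real.exp (-L u))
  set f' : ℝ → ℝ := fun u =>
    (μ + hawkesIntensity μ α (R ω) (fun i => t i ω) n u * (μ * (T - u))) * Real.exp (-L u)
  have hf : ∀ u, HasDerivAt f (f' u) u := by
    intro u
    have h1 := ((((hasDerivAt_id u).const_sub T).const_mul μ).mul
      (hasDerivAt_hawkesCompensator μ α (R ω) (fun i => t i ω) n s u).neg.exp).neg
    refine h1.congr_deriv ?_
    simp only [f', L, id, Pi.neg_apply]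
    ring
  have hcont : Continuous f' := by
    have hL : Continuous L := continuous_iff_continuousAt.2 fun u =>
      (hasDerivAt_hawkesCompensator μ α (R ω) (fun i => t i ω) n s u).continuousAt
    have := continuous_hawkesIntensity μ α (R ω) (fun i => t i ω) n
    fun_prop
  have hlam : ∀ u, 0 ≤ hawkesIntensity μ α (R ω) (fun i => t i ω) n u :=
    hawkesIntensity_nonneg hμ.le hα hR _ _
  have hpt : ∀ u, (hawkesDensity μ α R t n .immigrant (ω, u) *
        (ENNReal.ofReal (μ * (T - u)) + (Set.Iic T).indicator 1 u) +
      hawkesDensity μ α R t n .past (ω, u) * ENNReal.ofReal (μ * (T - u)) +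
      ∑ i ∈ Finset.range n, hawkesDensity μ α R t n (.event i) (ω, u) *
        ENNReal.ofReal (μ * (T - u))) =
      (Set.Iic T).indicator (fun u => ENNReal.ofReal (f' u)) u := by
    intro u
    by_cases hu : u ≤ T
    · have hv : 0 ≤ μ * (T - u) := mul_nonneg hμ.le (by linarith)
      have hd : ∀ k,
          0 ≤ hawkesCauseIntensity μ α (R ω) (fun i => t i ω) n k u * Real.exp (-L u) :=
        fun k => mul_nonneg (hawkesCauseIntensity_nonneg hμ.le hα hR _ _ _ _) (Real.exp_nonneg _)
      have hd' : ∀ k (v : ℝ), hawkesDensity μ α R t n k (ω, u) * ENNReal.ofReal v =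
          ENNReal.ofReal
            (hawkesCauseIntensity μ α (R ω) (fun i => t i ω) n k u * Real.exp (-L u) * v) :=
        fun k v => (ENNReal.ofReal_mul (hd k)).symm
      have hn : ∀ k (v : ℝ), 0 ≤ v →
          0 ≤ hawkesCauseIntensity μ α (R ω) (fun i => t i ω) n k u * Real.exp (-L u) * v :=
        fun k v hv => mul_nonneg (hd k) hv
      have h1 : (Set.Iic T).indicator (1 : ℝ → ENNReal) u = ENNReal.ofReal 1 := by
        simp [Set.indicator, hu]
      rw [h1, Set.indicator_of_mem (show u ∈ Set.Iic T from hu),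
        ← ENNReal.ofReal_add hv zero_le_one]
      simp only [hd']
      rw [← ENNReal.ofReal_sum_of_nonneg fun i _ => hn _ _ hv,
        ← ENNReal.ofReal_add (hn _ _ (by linarith)) (hn _ _ hv),
        ← ENNReal.ofReal_add (add_nonneg (hn _ _ (by linarith)) (hn _ _ hv))
          (Finset.sum_nonneg fun i _ => hn _ _ hv)]
      congr 1
      have : ∑ i ∈ Finset.range n, hawkesCauseIntensity μ α (R ω) (fun i => t i ω) n (.event i) u *
          Real.exp (-L u) * (μ * (T - u)) =
          (∑ i ∈ Finset.range n, α * Real.exp (-(u - t i ω))) * Real.exp (-L u) *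
            (μ * (T - u)) := by
        rw [Finset.sum_mul, Finset.sum_mul]
        refine Finset.sum_congr rfl fun i hi => ?_
        simp [hawkesCauseIntensity, Finset.mem_range.1 hi]
      rw [this]
      simp only [f', hawkesIntensity, hawkesCauseIntensity]
      ring
    -- After `T`, `ENNReal.ofReal` truncates the negative value to `0`, so no further immigrants are
    -- expected.
    · have h0 : ENNReal.ofReal (μ * (T - u)) = 0 :=
        ENNReal.ofReal_of_nonpos (mul_nonpos_of_nonneg_of_nonpos hμ.le (by linarith))
      simp [h0, hu]
  simp only [hpt]
  rw [lintegral_indicator measurableSet_Iic, Measure.restrict_restrict measurableSet_Iic,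
    Set.inter_comm, Set.Ioi_inter_Iic]
  rcases le_total s T with hsT | hsT
  · have hnn : ∀ u ∈ Set.Ioc s T, 0 ≤ f' u := fun u hu =>
      mul_nonneg (add_nonneg hμ.le (mul_nonneg (hlam u)
        (mul_nonneg hμ.le (by linarith [hu.2])))) (Real.exp_nonneg _)
    rw [← ofReal_integral_eq_lintegral_ofReal
      (hcont.integrableOn_Icc.mono_set Set.Ioc_subset_Icc_self)
      ((ae_restrict_iff' measurableSet_Ioc).2 (ae_of_all _ hnn)),
      ← intervalIntegral.integral_of_le hsT,
      intervalIntegral.integral_eq_sub_of_hasDerivAt (fun u _ => hf u)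
        (hcont.intervalIntegrable _ _)]
    simp [f, L, hawkesCompensator_self]
  · simp [Set.Ioc_eq_empty_of_le hsT]

/-! ### Mean number of immigrants -/

namespace IsHawkesProcess

variable {Ω : Type*} [mΩ : MeasurableSpace Ω] {P : Measure Ω} {𝓕 : Filtration ℕ mΩ} {μ α : ℝ}
  {R : Ω → ℝ} {t : ℕ → Ω → ℝ} {c : ℕ → Ω → HawkesCause}

theorem measurableSet_immigrant (hH : IsHawkesProcess P 𝓕 μ α R t c) (r : ℕ) (T : ℝ) :
    MeasurableSet[𝓕 (r + 1)] {ω | c r ω = .immigrant ∧ t r ω ≤ T} :=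
  (hH.measurable_cause r .immigrant).inter (hH.measurable_time r measurableSet_Iic)

theorem measure_immigrant_add_lintegral_le [IsProbabilityMeasure P]
    (hH : IsHawkesProcess P 𝓕 μ α R t c) (hμ : 0 < μ) (hα : 0 ≤ α) (n : ℕ) (T : ℝ) :
    P {ω | c n ω = .immigrant ∧ t n ω ≤ T} + ∫⁻ ω, ENNReal.ofReal (μ * (T - t n ω)) ∂P ≤
      ∫⁻ ω, ENNReal.ofReal (μ * (T - hawkesLastTime (fun i => t i ω) n)) ∂P := by
  classical
  -- The mean number of immigrants to come after the next event, plus one if that event is itself an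
  -- immigrant until `T`.
  let F : HawkesCause → Ω × ℝ → ENNReal := fun k z =>
    ENNReal.ofReal (μ * (T - z.2)) + if k = .immigrant then (Set.Iic T).indicator 1 z.2 else 0
  have hF : ∀ k, @Measurable _ _ (@Prod.instMeasurableSpace Ω ℝ (𝓕 n) _) _ (F k) := by
    intro k
    have h : Measurable fun u : ℝ => ENNReal.ofReal (μ * (T - u)) +
        if k = .immigrant then (Set.Iic T).indicator (1 : ℝ → ENNReal) u else 0 := by
      refine Measurable.add
        (by fun_prop : Measurable fun u : ℝ => ENNReal.ofReal (μ * (T - u))) ?_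
      split_ifs
      · exact measurable_one.indicator measurableSet_Iic
      · exact measurable_const
    exact h.comp (@measurable_snd Ω ℝ (𝓕 n) _)
  have hA := 𝓕.le _ _ (hH.measurableSet_immigrant n T)
  rw [← lintegral_indicator_one hA, add_comm, ← lintegral_add_right _ (measurable_one.indicator hA)]
  calc _ = ∫⁻ ω, F (c n ω) (ω, t n ω) ∂P := by
        refine lintegral_congr fun ω => ?_
        by_cases h1 : c n ω = .immigrant <;> by_cases h2 : t n ω ≤ T <;>
          simp [F, h1, h2, Set.indicator]
    _ ≤ _ := hH.lintegral_next n hF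
    _ ≤ _ := by
        refine lintegral_mono fun ω => ?_
        simpa [F] using lintegral_hawkesDensity_immigrant_le hμ hα t n T (hH.past_nonneg ω)

/-- The one-step inequalities telescope, starting from `μ T` because the waiting for the first event
begins at time `0`. -/
theorem tsum_measure_immigrant_le [IsProbabilityMeasure P]
    (hH : IsHawkesProcess P 𝓕 μ α R t c) (hμ : 0 < μ) (hα : 0 ≤ α) (T : ℝ) :
    ∑' n, P {ω | c n ω = .immigrant ∧ t n ω ≤ T} ≤ ENNReal.ofReal (μ * T) := by
  have key : ∀ n, ∑ i ∈ Finset.range n, P {ω | c i ω = .immigrant ∧ t i ω ≤ T} +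
      ∫⁻ ω, ENNReal.ofReal (μ * (T - hawkesLastTime (fun i => t i ω) n)) ∂P ≤
        ENNReal.ofReal (μ * T) := by
    intro n
    induction n with
    | zero => simp [hawkesLastTime]
    | succ n ih =>
      refine le_trans ?_ ih
      rw [Finset.sum_range_succ, add_assoc]
      exact add_le_add le_rfl (hH.measure_immigrant_add_lintegral_le hμ hα n T)
  rw [ENNReal.tsum_eq_iSup_nat]
  exact iSup_le fun n => le_self_add.trans (key n)

end IsHawkesProcess

/-! ### Growth of a tree in the order of arrival -/

open Classical in
/-- The events of the tree of `r` among the events numbered `0, …, n - 1`, in their order of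
arrival. -/
noncomputable def hawkesTreeUpTo (c : ℕ → HawkesCause) (r : ℕ) : ℕ → Finset ℕ
  | 0 => ∅
  | n + 1 =>
    if n = r ∨ ∃ i ∈ hawkesTreeUpTo c r n, c n = .event i then insert n (hawkesTreeUpTo c r n)
    else hawkesTreeUpTo c r n

theorem hawkesTreeUpTo_subset_range (c : ℕ → HawkesCause) (r n : ℕ) :
    hawkesTreeUpTo c r n ⊆ Finset.range n := by
  induction n with
  | zero => simp [hawkesTreeUpTo]
  | succ n ih =>
    have h := ih.trans (Finset.range_subset_range.2 n.le_succ)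
    rw [hawkesTreeUpTo]
    split_ifs
    · exact Finset.insert_subset (Finset.self_mem_range_succ n) h
    · exact h

theorem hawkesTreeUpTo_monotone (c : ℕ → HawkesCause) (r : ℕ) :
    Monotone (hawkesTreeUpTo c r) := by
  refine monotone_nat_of_le_succ fun n => ?_
  conv_rhs => rw [hawkesTreeUpTo]
  split_ifs
  · exact Finset.subset_insert _ _
  · exact le_rfl

theorem hawkesTreeUpTo_eq_empty (c : ℕ → HawkesCause) {r n : ℕ} (h : n ≤ r) :
    hawkesTreeUpTo c r n = ∅ := by
  induction n with
  | zero => rfl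
  | succ n ih =>
    have h' : n ≠ r := by omega
    rw [hawkesTreeUpTo, ih (by omega)]
    simp [h']

/-- A parent has a smaller number than its child, so it is already in the tree when the child is
processed. -/
theorem mem_hawkesTreeUpTo_succ {c : ℕ → HawkesCause} (hc : ∀ n i, c n = .event i → i < n)
    {r j : ℕ} (h : HawkesDescendant c r j) : j ∈ hawkesTreeUpTo c r (j + 1) := by
  induction h with
  | root => simp [hawkesTreeUpTo]
  | @child i j _ hij ih =>
    have h1 : i ∈ hawkesTreeUpTo c r j := hawkesTreeUpTo_monotone c r (hc j i hij) ih
    rw [hawkesTreeUpTo, if_pos (Or.inr ⟨i, h1, hij⟩)]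
    exact Finset.mem_insert_self _ _

theorem exists_subset_hawkesTreeUpTo {c : ℕ → HawkesCause} (hc : ∀ n i, c n = .event i → i < n)
    {r : ℕ} {S : Finset ℕ} (hS : (S : Set ℕ) ⊆ hawkesTree c r) :
    ∃ n, S ⊆ hawkesTreeUpTo c r n := by
  refine ⟨S.sup id + 1, fun j hj => ?_⟩
  exact hawkesTreeUpTo_monotone c r (Nat.succ_le_succ (Finset.le_sup (f := id) hj))
    (mem_hawkesTreeUpTo_succ hc (hS hj))

/-- Every finite part of the tree is present at some finite stage, so a bound uniform over the
stages passes to the whole tree; an infinite tree would contain `⌊x⌋₊ + 1` events at some stage. -/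
theorem finite_hawkesTree_and_ncard_le {c : ℕ → HawkesCause}
    (hc : ∀ n i, c n = .event i → i < n) {r : ℕ} {x : ℝ}
    (h : ∀ n, ((hawkesTreeUpTo c r n).card : ℝ) ≤ x) :
    (hawkesTree c r).Finite ∧ ((hawkesTree c r).ncard : ℝ) ≤ x := by
  have hfin : (hawkesTree c r).Finite := by
    by_contra hinf
    obtain ⟨S, hS, hcard⟩ := Set.Infinite.exists_subset_card_eq hinf (⌊x⌋₊ + 1)
    obtain ⟨n, hn⟩ := exists_subset_hawkesTreeUpTo hc hS
    have h1 : ((⌊x⌋₊ + 1 : ℕ) : ℝ) ≤ x := by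
      rw [← hcard]
      exact (Nat.cast_le.2 (Finset.card_le_card hn)).trans (h n)
    push_cast at h1
    linarith [Nat.lt_floor_add_one x]
  refine ⟨hfin, ?_⟩
  obtain ⟨n, hn⟩ := exists_subset_hawkesTreeUpTo hc (r := r) (S := hfin.toFinset) (by simp)
  rw [Set.ncard_eq_toFinset_card _ hfin]
  exact (Nat.cast_le.2 (Finset.card_le_card hn)).trans (h n)

/-! ### The exponential potential of a tree -/

/-- The weight `g` of a cause that belongs to the set `S` of events. -/
noncomputable def hawkesWeight (g : ℝ) (S : Finset ℕ) (k : HawkesCause) : ℝ :=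
  match k with
  | .event i => if i ∈ S then g else 1
  | _ => 1

theorem hawkesWeight_event (g : ℝ) (S : Finset ℕ) (i : ℕ) :
    hawkesWeight g S (.event i) = if i ∈ S then g else 1 := rfl

theorem one_le_hawkesWeight {g : ℝ} (hg : 1 ≤ g) (S : Finset ℕ) (k : HawkesCause) :
    1 ≤ hawkesWeight g S k := by
  cases k with
  | event i => rw [hawkesWeight_event]; split_ifs <;> simp [hg]
  | _ => exact le_rfl

/-- The exponential supermartingale for the size of a tree which at time `u` consists of the set
`S` of events. -/
noncomputable def hawkesPotential (α g : ℝ) (t : ℕ → ℝ) (n : ℕ) (S : Finset ℕ) (u : ℝ) : ℝ :=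
  Real.exp ((Real.log g - α * (g - 1)) * S.card +
    hawkesTilt α t n (fun i => hawkesWeight g S (.event i)) u)

/-- A new member adds `log g - α (g - 1)` through the cardinality and, at its birth, `α (g - 1)`
through its expected children. The coefficient in the potential is chosen so that the sum is `log
g`. -/
theorem hawkesPotential_insert (α : ℝ) {g : ℝ} (hg : 1 ≤ g) (t : ℕ → ℝ) {n : ℕ} {S : Finset ℕ}
    (hS : S ⊆ Finset.range n) :
    hawkesPotential α g t (n + 1) (insert n S) (t n) = g * hawkesPotential α g t n S (t n) := by
  have hn : n ∉ S := fun h => by simpa using hS h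
  have hsum : ∑ i ∈ Finset.range n, (hawkesWeight g (insert n S) (.event i) - 1) *
      (α * Real.exp (-(t n - t i))) = ∑ i ∈ Finset.range n, (hawkesWeight g S (.event i) - 1) *
      (α * Real.exp (-(t n - t i))) := by
    refine Finset.sum_congr rfl fun i hi => ?_
    have : i ≠ n := (Finset.mem_range.1 hi).ne
    simp [hawkesWeight_event, this]
  unfold hawkesPotential hawkesTilt
  rw [Finset.sum_range_succ, hsum, Finset.card_insert_of_notMem hn, ← Real.exp_log
    (show 0 < g by linarith), ← Real.exp_add]
  simp only [Real.log_exp, hawkesWeight_event, Finset.mem_insert_self, if_true]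
  congr 1
  push_cast
  simp
  ring

theorem hawkesPotential_of_subset_range (α g : ℝ) (t : ℕ → ℝ) {n : ℕ} {S : Finset ℕ}
    (hS : S ⊆ Finset.range n) (u : ℝ) :
    hawkesPotential α g t (n + 1) S u = hawkesPotential α g t n S u := by
  have hn : n ∉ S := fun h => by simpa using hS h
  unfold hawkesPotential hawkesTilt
  rw [Finset.sum_range_succ]
  simp [hawkesWeight_event, hn]

/-- The root is excluded because it joins the tree without a parent there: the potential would gain
a factor `g` that its cause does not carry. -/
theorem hawkesPotential_succ (α : ℝ) {g : ℝ} (hg : 1 ≤ g) (t : ℕ → ℝ) {c : ℕ → HawkesCause}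
    {r n : ℕ} (hn : n ≠ r) :
    hawkesPotential α g t (n + 1) (hawkesTreeUpTo c r (n + 1)) (t n) =
      hawkesWeight g (hawkesTreeUpTo c r n) (c n) *
        hawkesPotential α g t n (hawkesTreeUpTo c r n) (t n) := by
  have hsub := hawkesTreeUpTo_subset_range c r n
  by_cases h : ∃ i ∈ hawkesTreeUpTo c r n, c n = .event i
  · obtain ⟨i, hi, hci⟩ := h
    rw [hawkesTreeUpTo, if_pos (Or.inr ⟨i, hi, hci⟩), hawkesPotential_insert α hg t hsub, hci,
      hawkesWeight_event, if_pos hi]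
  · have hw : hawkesWeight g (hawkesTreeUpTo c r n) (c n) = 1 := by
      cases hc : c n with
      | event i => rw [hawkesWeight_event, if_neg fun hi => h ⟨i, hi, hc⟩]
      | _ => rfl
    rw [hawkesTreeUpTo, if_neg (not_or.2 ⟨hn, h⟩), hawkesPotential_of_subset_range α g t hsub, hw,
      one_mul]

/-- A function of a random finite set is measurable when the set is. -/
theorem measurable_comp_finset {Ω β : Type*} [MeasurableSpace Ω] [MeasurableSpace β]
    {S : Ω → Finset ℕ} (hS : ∀ K, MeasurableSet {ω | S ω = K}) (f : Finset ℕ → β) :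
    Measurable fun ω => f (S ω) := by
  intro B _
  have : (fun ω => f (S ω)) ⁻¹' B = ⋃ K ∈ f ⁻¹' B, {ω | S ω = K} := by
    ext ω; simp
  rw [this]
  exact MeasurableSet.biUnion (Set.to_countable _) fun K _ => hS K

theorem measurableSet_comp_finset {Ω : Type*} [MeasurableSpace Ω] {S : Ω → Finset ℕ}
    (hS : ∀ K, MeasurableSet {ω | S ω = K}) (p : Finset ℕ → Prop) :
    MeasurableSet {ω | p (S ω)} :=
  measurableSet_setOfPred.2 (measurable_comp_finset hS p)

theorem measurable_hawkesPotential {Ω : Type*} [MeasurableSpace Ω] (α g : ℝ)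
    {t : ℕ → Ω → ℝ} {n : ℕ} (ht : ∀ i < n, Measurable (t i)) {S : Ω → Finset ℕ}
    (hS : ∀ K, MeasurableSet {ω | S ω = K}) {A : Set Ω} (hA : MeasurableSet A) (k : HawkesCause) :
    Measurable fun z : Ω × ℝ => (A.indicator 1 z.1 : ENNReal) * ENNReal.ofReal
      (hawkesWeight g (S z.1) k * hawkesPotential α g (fun i => t i z.1) n (S z.1) z.2) := by
  have hf : ∀ f : Finset ℕ → ℝ, Measurable fun z : Ω × ℝ => f (S z.1) := fun f =>
    (measurable_comp_finset hS f).comp measurable_fst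
  have h1 : Measurable fun z : Ω × ℝ => hawkesTilt α (fun i => t i z.1) n
      (fun i => hawkesWeight g (S z.1) (.event i)) z.2 := by
    refine Finset.measurable_fun_sum _ fun i hi => ?_
    have hi' : Measurable fun z : Ω × ℝ => t i z.1 :=
      (ht i (Finset.mem_range.1 hi)).comp measurable_fst
    exact ((hf fun S => hawkesWeight g S (.event i)).sub_const 1).mul
      ((Real.measurable_exp.comp (measurable_snd.sub hi').neg).const_mul α)
  refine Measurable.mul ((measurable_one.indicator hA).comp measurable_fst)
    (ENNReal.measurable_ofReal.comp ?_)
  exact (hf fun S => hawkesWeight g S k).mul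
    (Real.measurable_exp.comp ((hf fun S => (Real.log g - α * (g - 1)) * S.card).add h1))

/-! ### Supermartingale property and tail bound -/

namespace IsHawkesProcess

variable {Ω : Type*} [mΩ : MeasurableSpace Ω] {P : Measure Ω} {𝓕 : Filtration ℕ mΩ} {μ α : ℝ}
  {R : Ω → ℝ} {t : ℕ → Ω → ℝ} {c : ℕ → Ω → HawkesCause}

theorem measurableSet_treeUpTo_eq (hH : IsHawkesProcess P 𝓕 μ α R t c) (r n : ℕ) (K : Finset ℕ) :
    MeasurableSet[𝓕 n] {ω | hawkesTreeUpTo (fun j => c j ω) r n = K} := by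
  induction n generalizing K with
  | zero => simp [hawkesTreeUpTo]
  | succ n ih =>
    have hp : ∀ p : Finset ℕ → Prop,
        MeasurableSet[𝓕 (n + 1)] {ω | p (hawkesTreeUpTo (fun j => c j ω) r n)} := fun p =>
      𝓕.mono n.le_succ _ (@measurableSet_comp_finset Ω (𝓕 n) _ ih p)
    have hC : MeasurableSet[𝓕 (n + 1)]
        {ω | n = r ∨ ∃ i, i ∈ hawkesTreeUpTo (fun j => c j ω) r n ∧ c n ω = .event i} := by
      refine MeasurableSet.union (MeasurableSet.const _) ?_
      have : {ω | ∃ i, i ∈ hawkesTreeUpTo (fun j => c j ω) r n ∧ c n ω = .event i} =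
          ⋃ i, {ω | i ∈ hawkesTreeUpTo (fun j => c j ω) r n} ∩ {ω | c n ω = .event i} := by
        ext ω; simp
      change MeasurableSet[𝓕 (n + 1)]
        {ω | ∃ i, i ∈ hawkesTreeUpTo (fun j => c j ω) r n ∧ c n ω = .event i}
      rw [this]
      exact MeasurableSet.iUnion fun i =>
        (hp fun S => i ∈ S).inter (hH.measurable_cause n (.event i))
    have : {ω | hawkesTreeUpTo (fun j => c j ω) r (n + 1) = K} =
        ({ω | n = r ∨ ∃ i, i ∈ hawkesTreeUpTo (fun j => c j ω) r n ∧ c n ω = .event i} ∩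
          {ω | insert n (hawkesTreeUpTo (fun j => c j ω) r n) = K}) ∪
        ({ω | n = r ∨ ∃ i, i ∈ hawkesTreeUpTo (fun j => c j ω) r n ∧ c n ω = .event i}ᶜ ∩
          {ω | hawkesTreeUpTo (fun j => c j ω) r n = K}) := by
      ext ω
      by_cases h : n = r ∨ ∃ i, i ∈ hawkesTreeUpTo (fun j => c j ω) r n ∧ c n ω = .event i <;>
        simp only [Set.mem_ofPred_eq, Set.mem_union, Set.mem_inter_iff, Set.mem_compl_iff, h,
          hawkesTreeUpTo, if_true, if_false] <;> tauto
    rw [this]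
    exact (hC.inter (hp fun S => insert n S = K)).union (hC.compl.inter (hp fun S => S = K))

theorem setLIntegral_potential_succ_le [IsFiniteMeasure P]
    (hH : IsHawkesProcess P 𝓕 μ α R t c) (hμ : 0 < μ) (hα : 0 ≤ α) {g : ℝ} (hg : 1 ≤ g)
    {r n : ℕ} (hn : n ≠ r) {A : Set Ω} (hA : MeasurableSet[𝓕 n] A) :
    ∫⁻ ω in A, ENNReal.ofReal (hawkesPotential α g (fun i => t i ω) (n + 1)
        (hawkesTreeUpTo (fun j => c j ω) r (n + 1)) (t n ω)) ∂P ≤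
      ∫⁻ ω in A, ENNReal.ofReal (hawkesPotential α g (fun i => t i ω) n
        (hawkesTreeUpTo (fun j => c j ω) r n) (hawkesLastTime (fun i => t i ω) n)) ∂P := by
  have hF := @measurable_hawkesPotential Ω (𝓕 n) α g t n (fun _ hi => hH.measurable_time_of_lt hi)
    _ (hH.measurableSet_treeUpTo_eq r n) A hA
  rw [← lintegral_indicator (𝓕.le _ _ hA), ← lintegral_indicator (𝓕.le _ _ hA)]
  calc _ = ∫⁻ ω, A.indicator 1 ω * ENNReal.ofReal
          (hawkesWeight g (hawkesTreeUpTo (fun j => c j ω) r n) (c n ω) *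
            hawkesPotential α g (fun i => t i ω) n
              (hawkesTreeUpTo (fun j => c j ω) r n) (t n ω)) ∂P := by
        refine lintegral_congr fun ω => ?_
        by_cases hω : ω ∈ A
        · simp [hω, hawkesPotential_succ α hg (c := fun j => c j ω) (fun i => t i ω) hn]
        · simp [hω]
    _ ≤ _ := hH.lintegral_next n hF
    _ ≤ _ := by
        refine lintegral_mono fun ω => ?_
        by_cases hω : ω ∈ A
        · simp only [Set.indicator_of_mem hω, Pi.one_apply, one_mul]
          have := lintegral_hawkesDensity_mul_tilt_le hμ hα t n
            (w := fun i => hawkesWeight g (hawkesTreeUpTo (fun j => c j ω) r n) (.event i))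
            (fun i => zero_le_one.trans (one_le_hawkesWeight hg _ _))
            ((Real.log g - α * (g - 1)) * (hawkesTreeUpTo (fun j => c j ω) r n).card)
            (hH.past_nonneg ω)
          -- `hawkesWeight` reduces to `1` for immigration and for the past, so the two integrands
          -- agree definitionally.
          exact this
        · simp [hω]

/-- At stage `r + 1` the tree is the root alone and the potential equals `g`; afterwards its mean
over `A` does not increase. Having `P A` on the right allows the later sum over roots to produce the
mean number of immigrants. -/
theorem setLIntegral_potential_le [IsFiniteMeasure P]
    (hH : IsHawkesProcess P 𝓕 μ α R t c) (hμ : 0 < μ) (hα : 0 ≤ α) {g : ℝ} (hg : 1 ≤ g)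
    {r n : ℕ} (hn : r < n) {A : Set Ω} (hA : MeasurableSet[𝓕 (r + 1)] A) :
    ∫⁻ ω in A, ENNReal.ofReal (hawkesPotential α g (fun i => t i ω) n
        (hawkesTreeUpTo (fun j => c j ω) r n) (hawkesLastTime (fun i => t i ω) n)) ∂P ≤
      ENNReal.ofReal g * P A := by
  induction n, hn using Nat.le_induction with
  | base =>
    rw [← setLIntegral_const]
    refine lintegral_mono fun ω => ?_
    have h : hawkesTreeUpTo (fun j => c j ω) r (r + 1) = insert r ∅ := by
      rw [hawkesTreeUpTo, if_pos (Or.inl rfl), hawkesTreeUpTo_eq_empty _ le_rfl]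
    rw [h]
    simp only [hawkesLastTime]
    rw [hawkesPotential_insert α hg (fun i => t i ω) (Finset.empty_subset _)]
    simp [hawkesPotential, hawkesTilt, hawkesWeight_event]
  | succ n hn ih =>
    exact (hH.setLIntegral_potential_succ_le hμ hα hg (Nat.ne_of_gt hn)
      (𝓕.mono hn _ hA)).trans ih

/-- The exponential tail bound for the size of a tree. -/
theorem measure_inter_lt_card_treeUpTo_le [IsFiniteMeasure P]
    (hH : IsHawkesProcess P 𝓕 μ α R t c) (hμ : 0 < μ) (hα : 0 ≤ α) {g : ℝ} (hg : 1 ≤ g)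
    (hθ : 0 ≤ Real.log g - α * (g - 1)) (x : ℝ)
    {r : ℕ} {A : Set Ω} (hA : MeasurableSet[𝓕 (r + 1)] A) :
    P (A ∩ {ω | ∃ n, x < (hawkesTreeUpTo (fun j => c j ω) r n).card}) ≤
      ENNReal.ofReal (g * Real.exp (-((Real.log g - α * (g - 1)) * x))) * P A := by
  set θ := Real.log g - α * (g - 1)
  let B : ℕ → Set Ω := fun n => A ∩ {ω | x < (hawkesTreeUpTo (fun j => c j ω) r n).card}
  have hBmono : Monotone B := fun m n hmn =>
    Set.inter_subset_inter_right _ fun ω (hω : x < _) => hω.trans_le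
      (Nat.cast_le.2 (Finset.card_le_card (hawkesTreeUpTo_monotone _ r hmn)))
  have hB : A ∩ {ω | ∃ n, x < (hawkesTreeUpTo (fun j => c j ω) r n).card} = ⋃ n, B n := by
    ext ω; simp [B]
  have hBm : ∀ n, MeasurableSet (B n) := fun n => (𝓕.le _ _ hA).inter (𝓕.le n _
    (@measurableSet_comp_finset Ω (𝓕 n) _ (hH.measurableSet_treeUpTo_eq r n) fun S => x < S.card))
  have hlarge : ∀ n, r < n → P (B n) ≤ ENNReal.ofReal (g * Real.exp (-(θ * x))) * P A := by
    intro n hn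
    have h1 : ENNReal.ofReal (Real.exp (θ * x)) * P (B n) ≤ ENNReal.ofReal g * P A := by
      refine le_trans ?_ (hH.setLIntegral_potential_le hμ hα hg hn hA)
      refine le_trans ?_ (lintegral_mono_set (Set.inter_subset_left : B n ⊆ A))
      rw [← setLIntegral_const]
      refine setLIntegral_mono' (hBm n) fun ω hω => ENNReal.ofReal_le_ofReal ?_
      refine Real.exp_le_exp.2 ?_
      have h2 : θ * x ≤ θ * (hawkesTreeUpTo (fun j => c j ω) r n).card :=
        mul_le_mul_of_nonneg_left (le_of_lt hω.2) hθ
      -- Markov's inequality needs only the cardinality term; the tilt is nonnegative since all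
      -- weights are at least `1`.
      refine h2.trans (le_add_of_nonneg_right (Finset.sum_nonneg fun i _ => ?_))
      exact mul_nonneg (sub_nonneg.2 (one_le_hawkesWeight hg _ _)) (by positivity)
    calc P (B n) = ENNReal.ofReal (Real.exp (-(θ * x))) *
          (ENNReal.ofReal (Real.exp (θ * x)) * P (B n)) := by
          rw [← mul_assoc, ← ENNReal.ofReal_mul (Real.exp_nonneg _), ← Real.exp_add]
          simp
      _ ≤ ENNReal.ofReal (Real.exp (-(θ * x))) * (ENNReal.ofReal g * P A) := by gcongr
      _ = _ := by
          rw [← mul_assoc, ← ENNReal.ofReal_mul (Real.exp_nonneg _), mul_comm g]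
  rw [hB, hBmono.measure_iUnion]
  exact iSup_le fun n => (measure_mono (hBmono (le_max_left n (r + 1)))).trans
    (hlarge _ (le_max_right n (r + 1)))

end IsHawkesProcess

/-! ### Choice of the parameter and numerical estimates -/

/-- The parameter of the exponential bound for the total progeny of a Poisson(`α`) branching
process. -/
theorem exists_sq_div_two_le_log_sub {α : ℝ} (hα₀ : 0 ≤ α) (hα₁ : α < 1) :
    ∃ g, 1 ≤ g ∧ g ≤ Real.exp 2 ∧ (1 - α) ^ 2 / 2 ≤ Real.log g - α * (g - 1) := by
  have h2 : (1 : ℝ) ≤ Real.exp 2 := Real.one_le_exp (by norm_num)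
  -- The maximiser of `log g - α (g - 1)` is `g = 1 / α`; it is capped at `e²` to keep the prefactor
  -- bounded for small `α`.
  rcases le_total (Real.exp (-2)) α with h | h
  · have hα : 0 < α := (Real.exp_pos _).trans_le h
    refine ⟨α⁻¹, (one_le_inv₀ hα).2 hα₁.le, ?_, ?_⟩
    · rw [← inv_inv (Real.exp 2), ← Real.exp_neg]
      exact inv_anti₀ (Real.exp_pos _) h
    -- Here `θ = -log α - (1 - α)`, and the first two terms of the series of `-log (1 - x)` at `x =
    -- 1 - α` leave `(1 - α)² / 2`.
    · have hs := Real.hasSum_pow_div_log_of_abs_lt_one (x := 1 - α)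
        (by rw [abs_of_pos (by linarith)]; linarith)
      have := sum_le_hasSum (Finset.range 2)
        (fun i _ => div_nonneg (pow_nonneg (by linarith) _) (by positivity)) hs
      simp [Finset.sum_range_succ] at this
      rw [Real.log_inv, mul_sub, mul_inv_cancel₀ hα.ne']
      norm_num at this
      linarith
  · refine ⟨Real.exp 2, h2, le_rfl, ?_⟩
    rw [Real.log_exp]
    have h3 : α * (Real.exp 2 - 1) ≤ 1 := by
      calc α * (Real.exp 2 - 1) ≤ Real.exp (-2) * (Real.exp 2 - 1) :=
            mul_le_mul_of_nonneg_right h (by linarith)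
        _ ≤ 1 := by
            rw [mul_sub, ← Real.exp_add]
            norm_num
            positivity
    nlinarith

theorem mul_exp_neg_mul_le {μ α γ T g θ : ℝ} (hμ : 0 < μ) (hα₁ : α < 1) (hγ₀ : 0 < γ)
    (hT : (μ * Real.exp 2 / γ) ^ ((5 : ℝ) / 2) ≤ T) (hT1 : 1 ≤ T) (hg : g ≤ Real.exp 2)
    (hθ : (1 - α) ^ 2 / 2 ≤ θ) :
    g * Real.exp (-(θ * (3 * Real.log T / (1 - α) ^ 2))) * (μ * T) ≤ γ := by
  have hT0 : 0 < T := by linarith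
  have hb : 0 < μ * Real.exp 2 / γ := by positivity
  have hlog := Real.log_le_log (by positivity) hT
  rw [Real.log_rpow hb] at hlog
  have hb' : Real.exp 2 * μ = γ * Real.exp (Real.log (μ * Real.exp 2 / γ)) := by
    rw [Real.exp_log hb]; field_simp
  have hl0 : 0 ≤ Real.log T := Real.log_nonneg hT1
  have ha' : 0 < 1 - α := by linarith
  have ha : 0 < (1 - α) ^ 2 := pow_pos ha' 2
  have hx : 3 / 2 * Real.log T ≤ θ * (3 * Real.log T / (1 - α) ^ 2) := by
    calc 3 / 2 * Real.log T = (1 - α) ^ 2 / 2 * (3 * Real.log T / (1 - α) ^ 2) := by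
          have := ha'.ne'
          field_simp
      _ ≤ _ := mul_le_mul_of_nonneg_right hθ (by positivity)
  calc g * Real.exp (-(θ * (3 * Real.log T / (1 - α) ^ 2))) * (μ * T)
      ≤ Real.exp 2 * Real.exp (-(3 / 2 * Real.log T)) * (μ * T) := by gcongr
    _ = γ * Real.exp (Real.log (μ * Real.exp 2 / γ) - 1 / 2 * Real.log T) := by
        rw [← Real.exp_log hT0]
        rw [show Real.exp 2 * Real.exp (-(3 / 2 * Real.log (Real.exp (Real.log T)))) *
          (μ * Real.exp (Real.log T)) = (Real.exp 2 * μ) *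
          (Real.exp (-(3 / 2 * Real.log (Real.exp (Real.log T)))) * Real.exp (Real.log T)) by ring,
          hb', ← Real.exp_add, mul_assoc, ← Real.exp_add]
        congr 2
        simp only [Real.log_exp]
        ring
    _ ≤ γ * 1 := by
        refine mul_le_mul_of_nonneg_left ?_ hγ₀.le
        rw [Real.exp_le_one_iff]
        -- By `hlog`, `log (μ e² / γ) ≤ (2/5) log T`, which is at most `(1/2) log T` because `T ≥
        -- 1`.
        linarith
    _ = γ := mul_one γ

/-- For short observation the hypothesis forces `μ e² ≤ γ`, so even the mean number of immigrants is
at most `γ`. -/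
theorem mul_le_of_rpow_le {μ γ T : ℝ} (hμ : 0 < μ) (hγ₀ : 0 < γ)
    (hT : (μ * Real.exp 2 / γ) ^ ((5 : ℝ) / 2) ≤ T) (hT1 : T ≤ 1) : μ * T ≤ γ := by
  have hb : 0 < μ * Real.exp 2 / γ := by positivity
  have h1 : μ * Real.exp 2 / γ ≤ 1 := by
    by_contra! h
    linarith [Real.one_lt_rpow h (show (0 : ℝ) < 5 / 2 by norm_num)]
  rw [div_le_one hγ₀] at h1
  have h2 : (1 : ℝ) ≤ Real.exp 2 := Real.one_le_exp (by norm_num)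
  nlinarith

/-! ### Union bound and conclusion -/

namespace IsHawkesProcess

variable {Ω : Type*} [mΩ : MeasurableSpace Ω] {P : Measure Ω} {𝓕 : Filtration ℕ mΩ} {μ α : ℝ}
  {R : Ω → ℝ} {t : ℕ → Ω → ℝ} {c : ℕ → Ω → HawkesCause}

/-- If a bound `x` is exceeded by the tree of an immigrant with a probability at most `κ`, then the
union bound over the immigrants until `T` gives the probability `κ μ T`. -/
theorem le_measure_forall_tree [IsProbabilityMeasure P]
    (hH : IsHawkesProcess P 𝓕 μ α R t c) (hμ : 0 < μ) (hα : 0 ≤ α) {T x κ γ : ℝ} (hκ : 0 ≤ κ)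
    (hγ : 0 ≤ γ)
    (hκγ : κ * (μ * T) ≤ γ)
    (h : ∀ r, P ({ω | c r ω = .immigrant ∧ t r ω ≤ T} ∩
        {ω | ∃ n, x < (hawkesTreeUpTo (fun j => c j ω) r n).card}) ≤
      ENNReal.ofReal κ * P {ω | c r ω = .immigrant ∧ t r ω ≤ T}) :
    ENNReal.ofReal (1 - γ) ≤ P {ω | ∀ r : ℕ, c r ω = .immigrant → t r ω ≤ T →
      (hawkesTree (fun j => c j ω) r).Finite ∧
        ((hawkesTree (fun j => c j ω) r).ncard : ℝ) ≤ x} := by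
  set G := {ω | ∀ r : ℕ, c r ω = .immigrant → t r ω ≤ T →
      (hawkesTree (fun j => c j ω) r).Finite ∧
        ((hawkesTree (fun j => c j ω) r).ncard : ℝ) ≤ x}
  have hbad : P Gᶜ ≤ ENNReal.ofReal γ := by
    calc P Gᶜ ≤ P (⋃ r, {ω | c r ω = .immigrant ∧ t r ω ≤ T} ∩
        {ω | ∃ n, x < (hawkesTreeUpTo (fun j => c j ω) r n).card}) := by
          refine measure_mono_ae ?_
          filter_upwards [hH.ae_cause_lt] with ω hω hG
          by_contra hbad
          refine hG fun r h1 h2 => finite_hawkesTree_and_ncard_le hω fun n => ?_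
          by_contra! hn
          exact hbad (Set.mem_iUnion.2 ⟨r, ⟨h1, h2⟩, n, hn⟩)
      _ ≤ ∑' r, ENNReal.ofReal κ * P {ω | c r ω = .immigrant ∧ t r ω ≤ T} :=
          (measure_iUnion_le _).trans (ENNReal.tsum_le_tsum h)
      _ ≤ ENNReal.ofReal κ * ENNReal.ofReal (μ * T) := by
          rw [ENNReal.tsum_mul_left]
          gcongr
          exact hH.tsum_measure_immigrant_le hμ hα T
      _ ≤ ENNReal.ofReal γ := by
          rw [← ENNReal.ofReal_mul hκ]
          exact ENNReal.ofReal_le_ofReal hκγ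
  -- Subadditivity is enough, so the measurability of `G` is not needed.
  have h1 : 1 ≤ P G + P Gᶜ := by
    rw [← measure_univ (μ := P)]
    exact measure_univ_le_add_compl G
  rw [ENNReal.ofReal_sub _ hγ, ENNReal.ofReal_one]
  exact tsub_le_iff_right.2 (h1.trans (by gcongr))

end IsHawkesProcess

theorem mainTheorem3 {Ω : Type*} [mΩ : MeasurableSpace Ω] (P : Measure Ω) [IsProbabilityMeasure P]
    (𝓕 : Filtration ℕ mΩ) (μ α : ℝ) (hμ : 0 < μ) (hα₀ : 0 ≤ α) (hα₁ : α < 1)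
    (R : Ω → ℝ) (t : ℕ → Ω → ℝ) (c : ℕ → Ω → HawkesCause)
    (hH : IsHawkesProcess P 𝓕 μ α R t c)
    (γ T : ℝ) (hγ₀ : 0 < γ) (hγ₁ : γ ≤ 1)
    (hT : (μ * Real.exp 2 / γ) ^ ((5 : ℝ) / 2) ≤ T) :
    ENNReal.ofReal (1 - γ) ≤
      P {ω | ∀ r : ℕ, c r ω = HawkesCause.immigrant → t r ω ≤ T →
        (hawkesTree (fun j => c j ω) r).Finite ∧
          ((hawkesTree (fun j => c j ω) r).ncard : ℝ) ≤ 3 * Real.log T / (1 - α) ^ 2} := by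
  rcases le_total T 1 with hT1 | hT1
  -- With `log T ≤ 0` the size bound fails for every tree, so `κ = 1` is used: the bad event is the
  -- arrival of any immigrant.
  · refine hH.le_measure_forall_tree hμ hα₀ zero_le_one hγ₀.le
      (by rw [one_mul]; exact mul_le_of_rpow_le hμ hγ₀ hT hT1) fun r => ?_
    rw [ENNReal.ofReal_one, one_mul]
    exact measure_mono Set.inter_subset_left
  · obtain ⟨g, hg1, hg2, hθ⟩ := exists_sq_div_two_le_log_sub hα₀ hα₁
    exact hH.le_measure_forall_tree hμ hα₀
      (mul_nonneg (zero_le_one.trans hg1) (Real.exp_nonneg _)) hγ₀.le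
      (mul_exp_neg_mul_le hμ hα₁ hγ₀ hT hT1 hg2 hθ) fun r =>
      hH.measure_inter_lt_card_treeUpTo_le hμ hα₀ hg1 ((by positivity : (0 : ℝ) ≤ _).trans hθ) _
        (hH.measurableSet_immigrant r T)
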